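/- Let $\mathbb{D}$ be the open unit disk, let $H^2\subset L^2(\partial\mathbb{D})$ be the Hardy space (identified with boundary values, with normalized arc length on $\partial\mathbb{D}$), and for an inner function $\alpha$ let $K_\alpha=H^2\ominus\alpha H^2$ and let $P_\alpha$ be the orthogonal projection of $L^2(\partial\mathbb{D})$ onto $K_\alpha$. For $w\in\mathbb{D}$ put $$k_w^\alpha(z)=\frac{1-\overline{\alpha(w)}\alpha(z)}{1-\overline{w}z},\qquad \widetilde k_w^\alpha=C_\alpha k_w^\alpha,\quad\text{where } C_\alpha f(z)=\alpha(z)\overline{z}\,\overline{f(z)}\ \ (|z|=1),$$ so that $\widetilde k_w^\alpha(z)=\frac{\alpha(z)-\alpha(w)}{z-w}$. We say that $\alpha$ has an angular derivative in the sense of Carathéodory (an ADC) at $\eta\in\partial\mathbb{D}$ if both $\alpha$ and $\alpha'$ have nontangential limits at $\eta$ and the nontangential limit $\alpha(\eta)$ of $\alpha$ satisfies $|\alpha(\eta)|=1$; in that case $k_\eta^\alpha$ is defined by the same formula with $\eta$ in place of $w$. For inner functions $\alpha,\beta$ and $\varphi\in L^2(\partial\mathbb{D})$ let $A_\varphi^{\alpha,\beta}$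 be the operator from $K_\alpha$ to $K_\beta$ given by $A_\varphi^{\alpha,\beta}f=P_\beta(\varphi f)$ for all $f\in K_\alpha$ with $\varphi f\in L^2(\partial\mathbb{D})$. It is densely defined; if it is bounded, it is identified with its bounded extension to $K_\alpha$. Let $\mathcal{T}(\alpha,\beta)$ be the set of all bounded operators $A_\varphi^{\alpha,\beta}$, $\varphi\in L^2(\partial\mathbb{D})$. For $g\in K_\beta$, $h\in K_\alpha$ let $g\otimes h$ be the operator $f\mapsto\langle f,h\rangle g$ from $K_\alpha$ to $K_\beta$. Let $\alpha,\beta$ be two nonconstant inner functions. (a) For every $w\in\mathbb{D}$, the functions $k_w^\alpha,\widetilde k_w^\alpha$ belong to $K_\alpha$, the functions $k_w^\beta,\widetilde k_w^\beta$ belong to $K_\beta$, the operators $\widetilde k_w^\beta\otimes k_w^\alpha$ and $k_w^\beta\otimes\widetilde k_w^\alpha$ belong to $\mathcal{T}(\alpha,\beta)$, and $$\widetilde k_w^\beta\otimes k_w^\alpha=A^{\alpha,\beta}_{\frac{\beta(z)}{z-w}},\qquad k_w^\beta\otimes\widetilde k_w^\alpha=A^{\alpha,\beta}_{\frac{\overline{\alpha(z)}}{\overline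 z-\overline w}}.$$ (b) If both $\alpha$ and $\beta$ have an ADC at the point $\eta\in\partial\mathbb{D}$, then $k_\eta^\alpha\in K_\alpha$, $k_\eta^\beta\in K_\beta$, the operator $k_\eta^\beta\otimes k_\eta^\alpha$ belongs to $\mathcal{T}(\alpha,\beta)$, and $$k_\eta^\beta\otimes k_\eta^\alpha=A^{\alpha,\beta}_{k_\eta^\beta+\overline{k_\eta^\alpha}-1}.$$ -/

import Mathlib

open MeasureTheory Filter Topology ComplexConjugate

noncomputable section

namespace ModelSpaces

/-- The unit circle `∂𝔻`, parametrized by `t ↦ e^{2πit}`, `t ∈ ℝ/ℤ`. -/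
abbrev Circ : Type := UnitAddCircle

/-- The point `e^{2πit}` of `∂𝔻`. -/
abbrev pt (t : Circ) : ℂ := fourier 1 t

/-- Normalized arc length measure on `∂𝔻`. -/
abbrev arc : Measure Circ := AddCircle.haarAddCircle

/-- The space `L²(∂𝔻)`. -/
abbrev L2 : Type := Lp ℂ 2 arc

/-- The Hardy space `H²`, identified through boundary values with the functions in `L²(∂𝔻)` whose
Fourier coefficients with negative indices vanish. -/
def hardy : Submodule ℂ L2 where
  carrier := {f | ∀ n : ℤ, n < 0 → fourierCoeff (f : Circ → ℂ) n = 0}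
  zero_mem' := by
    intro n _
    rw [← fourierBasis_repr]
    simp
  add_mem' := by
    intro f g hf hg n hn
    have h1 := hf n hn
    have h2 := hg n hn
    rw [← fourierBasis_repr] at h1 h2 ⊢
    simp [h1, h2]
  smul_mem' := by
    intro c f hf n hn
    have h1 := hf n hn
    rw [← fourierBasis_repr] at h1 ⊢
    simp [h1]

theorem isClosed_hardy : IsClosed (hardy : Set L2) := by
  have h : (hardy : Set L2) =
      ⋂ n : ℤ, ⋂ _ : n < 0, {f : L2 | inner ℂ (fourierBasis (T := 1) n) f = 0} := by
    ext f
    simp only [Set.mem_iInter, Set.mem_ofPred_eq]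
    refine forall₂_congr fun n _ => ?_
    rw [← fourierBasis_repr, HilbertBasis.repr_apply_apply]
  rw [h]
  refine isClosed_iInter fun n => isClosed_iInter fun _ => ?_
  exact isClosed_eq (by fun_prop) continuous_const

/-- The boundary function of `α : 𝔻 → ℂ`, given by its radial limits. -/
def bdry (α : ℂ → ℂ) (t : Circ) : ℂ :=
  limUnder (𝓝[<] (1 : ℝ)) fun r : ℝ => α ((r : ℂ) * pt t)

/-- Inner functions: bounded analytic functions on `𝔻` whose radial limits (exist and) have modulus
one almost everywhere on `∂𝔻`. Only the values of `α` on `𝔻` matter. -/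
structure IsInner (α : ℂ → ℂ) : Prop where
  analytic : DifferentiableOn ℂ α (Metric.ball 0 1)
  bounded : ∃ M : ℝ, ∀ z ∈ Metric.ball (0 : ℂ) 1, ‖α z‖ ≤ M
  unimodular : ∀ᵐ t ∂arc, ∃ c : ℂ, ‖c‖ = 1 ∧
    Tendsto (fun r : ℝ => α ((r : ℂ) * pt t)) (𝓝[<] (1 : ℝ)) (𝓝 c)

/-- `α` is not constant on `𝔻`. -/
def NonconstantOnDisk (α : ℂ → ℂ) : Prop :=
  ¬ ∃ c : ℂ, ∀ z ∈ Metric.ball (0 : ℂ) 1, α z = c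

/-- `α H²`, as a subspace of `L²(∂𝔻)`. -/
def mulHardy (α : ℂ → ℂ) : Submodule ℂ L2 where
  carrier := {g | ∃ h ∈ hardy, (g : Circ → ℂ) =ᵐ[arc] fun t => bdry α t * h t}
  zero_mem' := by
    refine ⟨0, hardy.zero_mem, ?_⟩
    filter_upwards [Lp.coeFn_zero ℂ 2 arc] with t ht
    simp
  add_mem' := by
    rintro f g ⟨h, hh, hf⟩ ⟨k, hk, hg⟩
    refine ⟨h + k, hardy.add_mem hh hk, ?_⟩
    filter_upwards [hf, hg, Lp.coeFn_add f g, Lp.coeFn_add h k] with t h1 h2 h3 h4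
    rw [h3, h4, Pi.add_apply, Pi.add_apply, h1, h2, mul_add]
  smul_mem' := by
    rintro c f ⟨h, hh, hf⟩
    refine ⟨c • h, hardy.smul_mem c hh, ?_⟩
    filter_upwards [hf, Lp.coeFn_smul c f, Lp.coeFn_smul c h] with t h1 h2 h3
    rw [h2, h3, Pi.smul_apply, Pi.smul_apply, h1, smul_eq_mul, smul_eq_mul]
    ring

/-- The model space `K_α = H² ⊖ α H²`. -/
def modelSpace (α : ℂ → ℂ) : Submodule ℂ L2 := hardy ⊓ (mulHardy α)ᗮ

instance completeSpace_modelSpace (α : ℂ → ℂ) : CompleteSpace (modelSpace α) :=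
  (isClosed_hardy.inter (Submodule.isClosed_orthogonal (mulHardy α))).completeSpace_coe

/-- The domain `{f ∈ K_α : φ f ∈ L²(∂𝔻)}`. -/
def toeplitzDomain (α : ℂ → ℂ) (φ : Circ → ℂ) : Submodule ℂ (modelSpace α) where
  carrier := {f | MemLp (fun t => φ t * (f : L2) t) 2 arc}
  zero_mem' := by
    refine (memLp_congr_ae ?_).mpr (MemLp.zero' (p := 2) (μ := arc) (ε := ℂ))
    filter_upwards [Lp.coeFn_zero ℂ 2 arc] with t ht
    rw [Submodule.coe_zero, ht, Pi.zero_apply, mul_zero]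
  add_mem' := by
    intro f g hf hg
    refine (memLp_congr_ae ?_).mpr (MemLp.add hf hg)
    filter_upwards [Lp.coeFn_add (f : L2) (g : L2)] with t ht
    rw [Submodule.coe_add, ht, Pi.add_apply, Pi.add_apply, mul_add]
  smul_mem' := by
    intro c f hf
    refine (memLp_congr_ae ?_).mpr (MemLp.const_smul hf c)
    filter_upwards [Lp.coeFn_smul c (f : L2)] with t ht
    rw [Submodule.coe_smul, ht, Pi.smul_apply, Pi.smul_apply, smul_eq_mul, smul_eq_mul,
      mul_left_comm]

/-- The asymmetric truncated Toeplitz operator `A_φ^{α,β} f = P_β (φ f)` with symbol `φ`, as a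
possibly unbounded operator from `K_α` to `K_β`. Its domain consists of all `f ∈ K_α` with
`φ f ∈ L²(∂𝔻)`, and contains in particular the bounded functions in `K_α` if `φ ∈ L²(∂𝔻)`. -/
def toeplitz (α β : ℂ → ℂ) (φ : Circ → ℂ) : modelSpace α →ₗ.[ℂ] modelSpace β where
  domain := toeplitzDomain α φ
  toFun :=
    { toFun := fun f => (modelSpace β).orthogonalProjectionOnto
        (MemLp.toLp (fun t => φ t * ((f : modelSpace α) : L2) t) f.2)
      map_add' := by
        intro f g
        rw [← map_add, ← MemLp.toLp_add f.2 g.2]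
        refine congrArg _ (MemLp.toLp_congr _ _ ?_)
        filter_upwards [Lp.coeFn_add ((f : modelSpace α) : L2) ((g : modelSpace α) : L2)] with t ht
        rw [Submodule.coe_add, Submodule.coe_add, ht, Pi.add_apply, Pi.add_apply, mul_add]
      map_smul' := by
        intro c f
        rw [RingHom.id_apply, ← map_smul, ← MemLp.toLp_const_smul c f.2]
        refine congrArg _ (MemLp.toLp_congr _ _ ?_)
        filter_upwards [Lp.coeFn_smul c ((f : modelSpace α) : L2)] with t ht
        rw [Submodule.coe_smul, Submodule.coe_smul, ht, Pi.smul_apply, Pi.smul_apply, smul_eq_mul,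
          smul_eq_mul, mul_left_comm] }

/-- `T = A_φ^{α,β}` for a bounded operator `T : K_α → K_β`: the symbol `φ` belongs to `L²(∂𝔻)`, the
operator `A_φ^{α,β}` is densely defined, and it agrees with `T` wherever it is defined (so it is
bounded and `T` is its unique bounded extension to `K_α`). -/
structure IsToeplitz {α β : ℂ → ℂ} (T : modelSpace α →L[ℂ] modelSpace β) (φ : Circ → ℂ) :
    Prop where
  memLp : MemLp φ 2 arc
  dense : Dense ((toeplitz α β φ).domain : Set (modelSpace α))
  eq : ∀ f : (toeplitz α β φ).domain, toeplitz α β φ f = T f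

/-- The class `𝒯(α,β)` of all bounded asymmetric truncated Toeplitz operators with symbols in
`L²(∂𝔻)`. -/
def toeplitzClass (α β : ℂ → ℂ) : Set (modelSpace α →L[ℂ] modelSpace β) :=
  {T | ∃ φ : Circ → ℂ, IsToeplitz T φ}

/-- Boundary values of `z ↦ (1 - conj a * α z) / (1 - conj w * z)`. This is the kernel `k_w^α` for
`a = α w`; here `w` is a point of `𝔻`, or a point of `∂𝔻` at which `α` has nontangential
limit `a`. -/
def kernel (α : ℂ → ℂ) (w a : ℂ) (t : Circ) : ℂ :=
  (1 - conj a * bdry α t) / (1 - conj w * pt t)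

/-- The conjugation `C_α f (z) = α z * conj z * conj (f z)`, `|z| = 1`. -/
def conjugation (α : ℂ → ℂ) (f : Circ → ℂ) (t : Circ) : ℂ :=
  bdry α t * conj (pt t) * conj (f t)

/-- The conjugate kernel `C_α k_w^α`, `w ∈ 𝔻`. -/
def conjKernel (α : ℂ → ℂ) (w : ℂ) : Circ → ℂ := conjugation α (kernel α w (α w))

theorem conjKernel_eq {α : ℂ → ℂ} {w : ℂ} {t : Circ} (ht : ‖bdry α t‖ = 1) :
    conjKernel α w t = (bdry α t - α w) / (pt t - w) := by
  have h1 : bdry α t * conj (bdry α t) = 1 := by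
    rw [Complex.mul_conj', ht]; norm_num
  have hz : ‖pt t‖ = 1 := by rw [pt, fourier_apply, Circle.norm_coe]
  have h2 : pt t * conj (pt t) = 1 := by
    rw [Complex.mul_conj', hz]; norm_num
  have h3 : pt t ≠ 0 := by
    intro h
    rw [h] at hz
    norm_num at hz
  have h4 : (1 : ℂ) - w * conj (pt t) = (pt t - w) * conj (pt t) := by linear_combination -h2
  have h5 : conj (pt t) ≠ 0 := (map_ne_zero _).mpr h3
  simp only [conjKernel, conjugation, kernel, map_div₀, map_sub, map_mul, map_one,
    Complex.conj_conj]
  rw [h4, mul_assoc, mul_div_assoc', mul_comm (conj (pt t)) (1 - _), mul_div_mul_right _ _ h5,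
    mul_div_assoc']
  congr 1
  linear_combination (-α w) * h1

/-- `f z` tends to `a` as `z ∈ 𝔻` tends to `η` nontangentially, that is, within each region
`|z - η| ≤ C (1 - |z|)`. -/
def NontangentialLimit (f : ℂ → ℂ) (η a : ℂ) : Prop :=
  ∀ C : ℝ, 0 < C →
    Tendsto f (𝓝[{z : ℂ | ‖z‖ < 1 ∧ ‖z - η‖ ≤ C * (1 - ‖z‖)}] η) (𝓝 a)

/-- `α` has an angular derivative in the sense of Carathéodory at `η`, and `a` is its nontangential
limit `α(η)` there. -/
structure HasADC (α : ℂ → ℂ) (η a : ℂ) : Prop where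
  limit : NontangentialLimit α η a
  deriv_limit : ∃ a' : ℂ, NontangentialLimit (deriv α) η a'
  unimodular : ‖a‖ = 1

end ModelSpaces

end

open ModelSpaces InnerProductSpace

namespace ModelSpaces

/-! ### The unit circle -/

/-! The method is Fourier analysis on the circle. Since `|α| = 1` almost everywhere, `f ∈ K_α` means
that `f` has no negative frequencies and `ᾱ f` no nonnegative ones (`IsInner.mem_modelSpace_iff`),
and `L²` splits orthogonally into `K_β`, `β H²` and the functions with only negative frequencies.
Hence `P_β ψ` is found by writing `ψ` as a sum of three such terms
(`IsInner.orthogonalProjectionOnto_eq`).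

For (a), the decomposition of `β f / (z - w)` is `f(w) k̃_w^β + β (f - f(w)) / (z - w) + f(w) β(w) /
(z - w)`, and `f(w) = ⟨f, k_w^α⟩` by the reproducing property. The second formula is the adjoint of
the first with `α` and `β` interchanged.

For (b), the identity `‖k_w^α‖² = (1 - |α(w)|²) / (1 - |w|²)` stays bounded as `w → η` radially,
because the angular derivative gives `|α(rη) - α(η)| ≤ M (1 - r)`. Fatou's lemma then puts `(α -
α(η)) / (z - η)` in `L²`, hence in `H²`, and this gives `k_η^α ∈ K_α`. The operator identity is
checked by a similar decomposition, but only on kernels `k_u`, `|u| < 1`, whose difference quotients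
at `η` are square integrable. It passes to every `f` in the domain by pairing with kernels of the
target space and moving the symbol to the other side: conjugating `k_η^β + conj k_η^α - 1` merely
exchanges `α` and `β`. -/

theorem norm_pt (t : Circ) : ‖pt t‖ = 1 := by rw [pt, fourier_apply, Circle.norm_coe]

theorem pt_ne_zero (t : Circ) : pt t ≠ 0 := by
  intro h
  have := norm_pt t
  rw [h] at this
  norm_num at this

theorem pt_mul_conj (t : Circ) : pt t * conj (pt t) = 1 := by
  rw [Complex.mul_conj', norm_pt]; norm_num

theorem continuous_pt : Continuous pt := (fourier 1).continuous

theorem fourier_eq_zpow (n : ℤ) (t : Circ) : (fourier n t : ℂ) = pt t ^ n := by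
  rw [pt, fourier_apply, fourier_apply, one_zsmul, AddCircle.toCircle_zsmul]
  simp

theorem conj_fourier (n : ℤ) (t : Circ) : conj (fourier n t : ℂ) = fourier (-n) t :=
  fourier_neg.symm

instance nullSingletonClass_arc : NullSingletonClass arc := by
  have h : (volume : Measure Circ) = arc := by
    have := AddCircle.volume_eq_smul_haarAddCircle (T := 1)
    rwa [ENNReal.ofReal_one, one_smul] at this
  rw [← h]
  refine ⟨fun x => ?_⟩
  have := AddCircle.volume_closedBall (T := 1) (x := x) 0
  rw [Metric.closedBall_zero] at this
  rw [this]
  simp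

theorem ae_pt_ne (w : ℂ) : ∀ᵐ t ∂arc, pt t ≠ w := by
  by_cases h : ∃ s, pt s = w
  · obtain ⟨s, rfl⟩ := h
    refine (measure_eq_zero_iff_ae_notMem (μ := arc) (s := {s})).mp (measure_singleton s) |>.mono ?_
    intro t ht h
    apply ht
    rw [pt, pt, fourier_apply, fourier_apply, one_zsmul, one_zsmul, Circle.coe_inj] at h
    exact AddCircle.injective_toCircle one_ne_zero h
  · push Not at h
    exact Eventually.of_forall h

/-! ### Square integrable functions on the circle -/

theorem memLp_bdd_mul {f g : Circ → ℂ} {C : ℝ} (hg : AEStronglyMeasurable g arc)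
    (hC : ∀ᵐ t ∂arc, ‖g t‖ ≤ C) (hf : MemLp f 2 arc) : MemLp (fun t => g t * f t) 2 arc := by
  refine hf.of_le_mul (c := C) (hg.mul hf.1) ?_
  filter_upwards [hC] with t ht
  rw [norm_mul]
  gcongr

theorem memLp_continuous_mul {f g : Circ → ℂ} (hg : Continuous g) (hf : MemLp f 2 arc) :
    MemLp (fun t => g t * f t) 2 arc := by
  obtain ⟨C, hC⟩ := isCompact_univ.exists_bound_of_continuousOn hg.continuousOn
  exact memLp_bdd_mul hg.aestronglyMeasurable (Eventually.of_forall fun t => hC t trivial) hf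

theorem memLp_continuous {g : Circ → ℂ} (hg : Continuous g) : MemLp g 2 arc := by
  simpa using memLp_continuous_mul hg (memLp_const 1)

theorem memLp_conj {f : Circ → ℂ} (hf : MemLp f 2 arc) : MemLp (fun t => conj (f t)) 2 arc :=
  hf.star

theorem integrable_conj_mul {f g : Circ → ℂ} (hf : MemLp f 2 arc) (hg : MemLp g 2 arc) :
    Integrable (fun t => conj (f t) * g t) arc :=
  (memLp_conj hf).integrable_mul hg

theorem inner_eq_integral {f g : L2} {f' g' : Circ → ℂ} (hf : (f : Circ → ℂ) =ᵐ[arc] f')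
    (hg : (g : Circ → ℂ) =ᵐ[arc] g') : inner ℂ f g = ∫ t, conj (f' t) * g' t ∂arc := by
  rw [L2.inner_def]
  refine integral_congr_ae ?_
  filter_upwards [hf, hg] with t h1 h2
  rw [RCLike.inner_apply, h1, h2, mul_comm]

/-! ### Fourier coefficients -/

theorem fourierCoeff_sub {f g : Circ → ℂ} (hf : MemLp f 2 arc) (hg : MemLp g 2 arc) (n : ℤ) :
    fourierCoeff (fun t => f t - g t) n = fourierCoeff f n - fourierCoeff g n := by
  have h1 := (hf.integrable one_le_two).fourier_smul (-n)
  have h2 := (hg.integrable one_le_two).fourier_smul (-n)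
  simp only [fourierCoeff, smul_sub]
  exact integral_sub h1 h2

theorem fourierCoeff_fourier_mul (m : ℤ) (f : Circ → ℂ) (n : ℤ) :
    fourierCoeff (fun t => (fourier m t : ℂ) * f t) n = fourierCoeff f (n - m) := by
  simp only [fourierCoeff, smul_eq_mul, ← mul_assoc, ← fourier_add]
  rw [neg_sub, neg_add_eq_sub]

theorem fourierCoeff_pt_mul (f : Circ → ℂ) (n : ℤ) :
    fourierCoeff (fun t => pt t * f t) n = fourierCoeff f (n - 1) :=
  fourierCoeff_fourier_mul 1 f n

theorem fourierCoeff_conj_pt_mul (f : Circ → ℂ) (n : ℤ) :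
    fourierCoeff (fun t => conj (pt t) * f t) n = fourierCoeff f (n + 1) := by
  simp only [pt, conj_fourier, fourierCoeff_fourier_mul, sub_neg_eq_add]

theorem fourierCoeff_conj (f : Circ → ℂ) (n : ℤ) :
    fourierCoeff (fun t => conj (f t)) n = conj (fourierCoeff f (-n)) := by
  simp only [fourierCoeff, smul_eq_mul]
  rw [← integral_conj]
  simp only [map_mul, conj_fourier, neg_neg]

theorem fourierCoeff_coe_toLp {f : Circ → ℂ} (hf : MemLp f 2 arc) :
    fourierCoeff (hf.toLp f : Circ → ℂ) = fourierCoeff f :=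
  fourierCoeff_congr_ae hf.coeFn_toLp

theorem tendsto_fourierCoeff {f : Circ → ℂ} (hf : MemLp f 2 arc) :
    Tendsto (fourierCoeff f) cofinite (𝓝 0) := by
  have h := (hasSum_sq_fourierCoeff (hf.toLp f)).summable.tendsto_cofinite_zero
  rw [fourierCoeff_coe_toLp] at h
  rw [tendsto_zero_iff_norm_tendsto_zero]
  have := (Real.continuous_sqrt.tendsto 0).comp h
  simpa [Function.comp_def] using this

/-- Moving along the progression never decreases `‖a‖`, while the coefficients tend to zero. The
case `‖c‖ = 1` is allowed, which is what makes division by `z - η` possible at boundary points. -/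
theorem eq_zero_of_recurrence {a : ℤ → ℂ} {c : ℂ} (ha : Tendsto a cofinite (𝓝 0)) (hc : ‖c‖ ≤ 1)
    {σ m : ℤ} (hσ : σ ≠ 0) (h : ∀ k : ℕ, a (m + k * σ) = c * a (m + (k + 1 : ℕ) * σ)) :
    a m = 0 := by
  have h1 : ∀ k : ℕ, ‖a m‖ ≤ ‖a (m + k * σ)‖ := by
    intro k
    induction k with
    | zero => simp
    | succ k ih =>
      refine ih.trans ?_
      rw [h k, norm_mul]
      exact mul_le_of_le_one_left (norm_nonneg _) hc
  have hinj : Function.Injective fun k : ℕ => m + (k : ℤ) * σ := by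
    intro i j hij
    simpa [hσ] using hij
  have h2 := (ha.comp hinj.tendsto_cofinite).norm
  rw [Nat.cofinite_eq_atTop, norm_zero] at h2
  have := ge_of_tendsto' h2 h1
  exact norm_le_zero_iff.mp this

/-! ### Functions with one-sided spectrum -/

/-- Square integrable functions with vanishing Fourier coefficients of negative index. -/
structure IsHardy (f : Circ → ℂ) : Prop where
  memLp : MemLp f 2 arc
  coeff : ∀ n : ℤ, n < 0 → fourierCoeff f n = 0

/-- Square integrable functions with vanishing Fourier coefficients of nonnegative index. -/
structure IsCoHardy (f : Circ → ℂ) : Prop where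
  memLp : MemLp f 2 arc
  coeff : ∀ n : ℤ, 0 ≤ n → fourierCoeff f n = 0

theorem IsHardy.congr {f g : Circ → ℂ} (hf : IsHardy f) (h : f =ᵐ[arc] g) : IsHardy g :=
  ⟨(memLp_congr_ae h).mp hf.1, fun n hn => by rw [← fourierCoeff_congr_ae h, hf.2 n hn]⟩

theorem IsCoHardy.congr {f g : Circ → ℂ} (hf : IsCoHardy f) (h : f =ᵐ[arc] g) : IsCoHardy g :=
  ⟨(memLp_congr_ae h).mp hf.1, fun n hn => by rw [← fourierCoeff_congr_ae h, hf.2 n hn]⟩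

theorem IsHardy.sub {f g : Circ → ℂ} (hf : IsHardy f) (hg : IsHardy g) :
    IsHardy fun t => f t - g t :=
  ⟨hf.1.sub hg.1, fun n hn => by rw [fourierCoeff_sub hf.1 hg.1, hf.2 n hn, hg.2 n hn, sub_zero]⟩

theorem IsCoHardy.sub {f g : Circ → ℂ} (hf : IsCoHardy f) (hg : IsCoHardy g) :
    IsCoHardy fun t => f t - g t :=
  ⟨hf.1.sub hg.1, fun n hn => by rw [fourierCoeff_sub hf.1 hg.1, hf.2 n hn, hg.2 n hn, sub_zero]⟩

theorem IsHardy.const_mul {f : Circ → ℂ} (hf : IsHardy f) (c : ℂ) : IsHardy fun t => c * f t :=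
  ⟨hf.1.const_mul c, fun n hn => by rw [fourierCoeff.const_mul, hf.2 n hn, mul_zero]⟩

theorem IsCoHardy.const_mul {f : Circ → ℂ} (hf : IsCoHardy f) (c : ℂ) :
    IsCoHardy fun t => c * f t :=
  ⟨hf.1.const_mul c, fun n hn => by rw [fourierCoeff.const_mul, hf.2 n hn, mul_zero]⟩

theorem isHardy_const (c : ℂ) : IsHardy fun _ => c := by
  refine ⟨memLp_const c, fun n hn => ?_⟩
  have h : (fun _ : Circ => c) = fun t => c * (fourier 0 : C(Circ, ℂ)) t := by
    funext t; rw [fourier_zero, mul_one]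
  rw [h, fourierCoeff.const_mul, fourierCoeff_fourier, Pi.single_apply, if_neg hn.ne, mul_zero]

theorem IsHardy.conj_pt_mul {f : Circ → ℂ} (hf : IsHardy f) :
    IsCoHardy fun t => conj (pt t * f t) := by
  refine ⟨memLp_conj (memLp_continuous_mul continuous_pt hf.1), fun n hn => ?_⟩
  rw [fourierCoeff_conj, fourierCoeff_pt_mul, hf.2 _ (by omega), map_zero]

/-- Parseval: the two spectra are disjoint. -/
theorem IsHardy.integral_conj_mul {h f : Circ → ℂ} (hh : IsHardy h) (hf : IsCoHardy f) :
    ∫ t, conj (h t) * f t ∂arc = 0 := by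
  rw [← inner_eq_integral hh.1.coeFn_toLp hf.1.coeFn_toLp]
  have := fourierBasis (T := 1).hasSum_inner_mul_inner (hh.1.toLp h) (hf.1.toLp f)
  refine this.unique ?_
  convert hasSum_zero using 2 with n
  rw [← HilbertBasis.repr_apply_apply, ← inner_conj_symm, ← HilbertBasis.repr_apply_apply,
    fourierBasis_repr, fourierBasis_repr, fourierCoeff_coe_toLp, fourierCoeff_coe_toLp]
  rcases lt_or_ge n 0 with hn | hn
  · rw [hh.2 n hn, map_zero, zero_mul]
  · rw [hf.2 n hn, mul_zero]

theorem IsHardy.fourier_mul {f : Circ → ℂ} (hf : IsHardy f) {m : ℤ} (hm : 0 ≤ m) :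
    IsHardy fun t => (fourier m t : ℂ) * f t := by
  refine ⟨memLp_continuous_mul (fourier m).continuous hf.1, fun n hn => ?_⟩
  rw [fourierCoeff_fourier_mul, hf.2 _ (by omega)]

theorem isHardy_fourier {m : ℤ} (hm : 0 ≤ m) : IsHardy fun t => (fourier m t : ℂ) := by
  simpa using (isHardy_const 1).fourier_mul hm

/-! ### Division by linear factors -/

theorem fourierCoeff_one_sub_mul {f : Circ → ℂ} (hf : MemLp f 2 arc) (c : ℂ) (n : ℤ) :
    fourierCoeff (fun t => (1 - c * pt t) * f t) n =
      fourierCoeff f n - c * fourierCoeff f (n - 1) := by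
  have h : (fun t => (1 - c * pt t) * f t) = fun t => f t - c * (pt t * f t) := by
    funext t; ring
  rw [h, fourierCoeff_sub hf ((memLp_continuous_mul continuous_pt hf).const_mul c),
    fourierCoeff.const_mul, fourierCoeff_pt_mul]

theorem fourierCoeff_one_sub_conj_mul {f : Circ → ℂ} (hf : MemLp f 2 arc) (c : ℂ) (n : ℤ) :
    fourierCoeff (fun t => (1 - c * conj (pt t)) * f t) n =
      fourierCoeff f n - c * fourierCoeff f (n + 1) := by
  have h : (fun t => (1 - c * conj (pt t)) * f t) = fun t => f t - c * (conj (pt t) * f t) := by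
    funext t; ring
  have hm : MemLp (fun t => conj (pt t) * f t) 2 arc :=
    memLp_continuous_mul (Complex.continuous_conj.comp continuous_pt) hf
  rw [h, fourierCoeff_sub hf (hm.const_mul c),
    fourierCoeff.const_mul, fourierCoeff_conj_pt_mul]

/-- For `n < 0` the hypothesis says `ĝ(n) = c ĝ(n - 1)`, so the recurrence runs towards `-∞`. Square
integrability of `g` is essential when `‖c‖ = 1`. -/
theorem IsHardy.of_one_sub_mul {g : Circ → ℂ} {c : ℂ} (hg : MemLp g 2 arc) (hc : ‖c‖ ≤ 1)
    (h : IsHardy fun t => (1 - c * pt t) * g t) : IsHardy g := by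
  refine ⟨hg, fun n hn => eq_zero_of_recurrence (tendsto_fourierCoeff hg) hc
    (σ := -1) (by norm_num) fun k => ?_⟩
  have h1 := h.2 (n - k) (by omega)
  rw [fourierCoeff_one_sub_mul hg, sub_eq_zero] at h1
  convert h1 using 3 <;> push_cast <;> ring

theorem IsCoHardy.of_one_sub_conj_mul {g : Circ → ℂ} {c : ℂ} (hg : MemLp g 2 arc) (hc : ‖c‖ ≤ 1)
    (h : IsCoHardy fun t => (1 - c * conj (pt t)) * g t) : IsCoHardy g := by
  refine ⟨hg, fun n hn => eq_zero_of_recurrence (tendsto_fourierCoeff hg) hc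
    (σ := 1) (by norm_num) fun k => ?_⟩
  have h1 := h.2 (n + k) (by omega)
  rw [fourierCoeff_one_sub_conj_mul hg, sub_eq_zero] at h1
  convert h1 using 3 <;> push_cast <;> ring

/-- Here the relation is `ĝ(n - 1) = w ĝ(n)` for `n < 0`, which propagates downwards from `ĝ(-1)`.
That coefficient must therefore be known to vanish; it is the integral in `h0`. -/
theorem IsHardy.of_pt_sub_mul {g : Circ → ℂ} {w : ℂ} (hg : MemLp g 2 arc)
    (h : IsHardy fun t => (pt t - w) * g t) (h0 : ∫ t, pt t * g t ∂arc = 0) : IsHardy g := by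
  refine ⟨hg, fun n hn => ?_⟩
  have key : ∀ k : ℕ, fourierCoeff g (-1 - k) = 0 := by
    intro k
    induction k with
    | zero =>
      rw [← h0, fourierCoeff]
      simp
    | succ k ih =>
      have h1 := h.2 (-1 - k) (by omega)
      have e : (fun t => (pt t - w) * g t) = fun t => pt t * g t - w * g t := by
        funext t; ring
      rw [e, fourierCoeff_sub (memLp_continuous_mul continuous_pt hg) (hg.const_mul w),
        fourierCoeff_pt_mul, fourierCoeff.const_mul, ih, mul_zero, sub_zero] at h1
      rw [← h1]
      congr 1
      push_cast
      ring
  obtain ⟨k, hk⟩ := Int.eq_ofNat_of_zero_le (show 0 ≤ -1 - n by omega)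
  have := key k
  rwa [show (-1 - (k : ℤ)) = n by omega] at this

theorem IsHardy.of_pt_sub_mul_of_norm_eq_one {g : Circ → ℂ} {w : ℂ} (hg : MemLp g 2 arc)
    (hw : ‖w‖ = 1) (h : IsHardy fun t => (pt t - w) * g t) : IsHardy g := by
  refine IsHardy.of_one_sub_mul (c := conj w) hg (by rw [RCLike.norm_conj, hw])
    -- On the unit circle `-w̄ (z - w) = 1 - w̄ z`.
    ((h.const_mul (-conj w)).congr (Eventually.of_forall fun t => ?_))
  have : conj w * w = 1 := by rw [Complex.conj_mul', hw]; norm_num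
  simp only
  linear_combination g t * this

/-! ### Boundary values of inner functions -/

theorem integral_arc_eq_circleAverage (f : ℂ → ℂ) :
    ∫ t, f (pt t) ∂arc = Real.circleAverage f 0 1 := by
  have h : ∀ a : ℝ, f (pt (a : Circ)) = f (circleMap 0 1 (2 * Real.pi * a)) := by
    intro a
    congr 1
    simp only [pt, fourier_coe_apply, circleMap]
    push_cast
    simp only [zero_add, one_mul, mul_one, div_one]
    congr 1
    ring
  rw [AddCircle.integral_haarAddCircle, ← UnitAddCircle.intervalIntegral_preimage 0,
    Real.circleAverage_def]
  simp only [h]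
  rw [intervalIntegral.integral_comp_mul_left (fun θ => f (circleMap 0 1 θ)) (by positivity)]
  simp

theorem one_sub_mul_conj_pt (w : ℂ) (t : Circ) :
    1 - w * conj (pt t) = (pt t - w) * conj (pt t) := by
  linear_combination -pt_mul_conj t

theorem one_sub_conj_mul_pt (w : ℂ) (t : Circ) :
    1 - conj w * pt t = conj (pt t - w) * pt t := by
  rw [map_sub]
  linear_combination -pt_mul_conj t

theorem pt_sub_ne_zero {w : ℂ} (hw : ‖w‖ < 1) (t : Circ) : pt t - w ≠ 0 := by
  intro h
  rw [← sub_eq_zero.mp h, norm_pt] at hw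
  exact lt_irrefl _ hw

theorem one_sub_mul_conj_pt_ne_zero {w : ℂ} (hw : ‖w‖ < 1) (t : Circ) :
    1 - w * conj (pt t) ≠ 0 := by
  rw [one_sub_mul_conj_pt]
  exact mul_ne_zero (pt_sub_ne_zero hw t) ((map_ne_zero _).mpr (pt_ne_zero t))

theorem one_sub_conj_mul_pt_ne_zero {w : ℂ} (hw : ‖w‖ < 1) (t : Circ) :
    1 - conj w * pt t ≠ 0 := by
  rw [one_sub_conj_mul_pt]
  exact mul_ne_zero ((map_ne_zero _).mpr (pt_sub_ne_zero hw t)) (pt_ne_zero t)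

theorem pt_div_pt_sub (w : ℂ) (t : Circ) : pt t / (pt t - w) = 1 / (1 - w * conj (pt t)) := by
  rw [one_sub_mul_conj_pt, ← mul_div_mul_right (pt t) _ ((map_ne_zero conj).mpr (pt_ne_zero t)),
    pt_mul_conj]

/-- An increasing sequence of radii with limit one. -/
noncomputable def radius (n : ℕ) : ℝ := 1 - 1 / ((n : ℝ) + 1)

theorem radius_nonneg (n : ℕ) : 0 ≤ radius n := by
  rw [radius, sub_nonneg, div_le_one (by positivity)]
  linarith [n.cast_nonneg (α := ℝ)]

theorem radius_lt_one (n : ℕ) : radius n < 1 := by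
  rw [radius, sub_lt_self_iff]
  positivity

theorem tendsto_radius : Tendsto radius atTop (𝓝[<] 1) := by
  refine tendsto_nhdsWithin_iff.mpr ⟨?_, Eventually.of_forall radius_lt_one⟩
  have h := (tendsto_const_nhds (x := (1 : ℝ))).sub
    (tendsto_one_div_add_atTop_nhds_zero_nat (𝕜 := ℝ))
  rwa [sub_zero] at h

theorem norm_radius_mul_le {n : ℕ} {z : ℂ} (hz : ‖z‖ ≤ 1) : ‖(radius n : ℂ) * z‖ < 1 := by
  rw [norm_mul, Complex.norm_real, Real.norm_of_nonneg (radius_nonneg n)]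
  exact (mul_le_of_le_one_right (radius_nonneg n) hz).trans_lt (radius_lt_one n)

variable {α β : ℂ → ℂ}

theorem IsInner.tendsto_bdry (hα : IsInner α) : ∀ᵐ t ∂arc,
    Tendsto (fun r : ℝ => α ((r : ℂ) * pt t)) (𝓝[<] (1 : ℝ)) (𝓝 (bdry α t)) := by
  filter_upwards [hα.unimodular] with t ⟨c, _, hc⟩
  rwa [bdry, hc.limUnder_eq]

theorem IsInner.norm_bdry (hα : IsInner α) : ∀ᵐ t ∂arc, ‖bdry α t‖ = 1 := by
  filter_upwards [hα.unimodular] with t ⟨c, h, hc⟩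
  rwa [bdry, hc.limUnder_eq]

theorem IsInner.norm_bdry_le (hα : IsInner α) : ∀ᵐ t ∂arc, ‖bdry α t‖ ≤ 1 :=
  hα.norm_bdry.mono fun _ h => h.le

theorem IsInner.bdry_mul_conj (hα : IsInner α) : ∀ᵐ t ∂arc, bdry α t * conj (bdry α t) = 1 := by
  filter_upwards [hα.norm_bdry] with t ht
  rw [Complex.mul_conj', ht]; norm_num

theorem IsInner.continuous_radius (hα : IsInner α) (n : ℕ) :
    Continuous fun t : Circ => α ((radius n : ℂ) * pt t) := by
  refine hα.analytic.continuousOn.comp_continuous (continuous_const.mul continuous_pt) fun t => ?_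
  rw [mem_ball_zero_iff]
  exact norm_radius_mul_le (norm_pt t).le

theorem IsInner.aestronglyMeasurable_bdry (hα : IsInner α) :
    AEStronglyMeasurable (bdry α) arc := by
  refine aestronglyMeasurable_of_tendsto_ae atTop
    (f := fun n t => α ((radius n : ℂ) * pt t))
    (fun n => (hα.continuous_radius n).aestronglyMeasurable) ?_
  filter_upwards [hα.tendsto_bdry] with t ht
  exact ht.comp tendsto_radius

theorem IsInner.memLp_bdry (hα : IsInner α) : MemLp (bdry α) 2 arc := by
  simpa using memLp_bdd_mul hα.aestronglyMeasurable_bdry hα.norm_bdry_le (memLp_const (1 : ℂ))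

theorem IsInner.tendsto_integral_radius (hα : IsInner α) {g : Circ → ℂ} (hg : Continuous g) :
    Tendsto (fun n => ∫ t, g t * α ((radius n : ℂ) * pt t) ∂arc) atTop
      (𝓝 (∫ t, g t * bdry α t ∂arc)) := by
  obtain ⟨M, hM⟩ := hα.bounded
  refine tendsto_integral_of_dominated_convergence (fun t => ‖g t‖ * M)
    (fun n => (hg.mul (hα.continuous_radius n)).aestronglyMeasurable)
    (((memLp_continuous hg).integrable one_le_two).norm.mul_const M) (fun n => ?_) ?_
  · refine Eventually.of_forall fun t => ?_
    rw [norm_mul]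
    gcongr
    exact hM _ (mem_ball_zero_iff.mpr (norm_radius_mul_le (norm_pt t).le))
  · filter_upwards [hα.tendsto_bdry] with t ht
    exact (ht.comp tendsto_radius).const_mul _

theorem IsInner.diffContOnCl_radius (hα : IsInner α) (n : ℕ) :
    DiffContOnCl ℂ (fun z => α ((radius n : ℂ) * z)) (Metric.ball 0 1) := by
  have h : DifferentiableOn ℂ (fun z => α ((radius n : ℂ) * z)) (Metric.closedBall 0 1) := by
    refine hα.analytic.comp (differentiable_id.const_mul _).differentiableOn fun z hz => ?_
    rw [mem_closedBall_zero_iff] at hz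
    rw [mem_ball_zero_iff]
    exact norm_radius_mul_le hz
  refine DifferentiableOn.diffContOnCl ?_
  rwa [closure_ball _ one_ne_zero]

/-- Cauchy's formula: `dz / (2πi (z - w))` is `z / (z - w)` times normalized arc length. -/
theorem integral_cauchy {f : ℂ → ℂ} (hf : DiffContOnCl ℂ f (Metric.ball 0 1)) {w : ℂ}
    (hw : ‖w‖ < 1) : ∫ t, pt t / (pt t - w) * f (pt t) ∂arc = f w := by
  have h := DiffContOnCl.circleAverage_smul_div (f := f) (c := 0) (R := 1) (w := w)
    (by rwa [abs_one]) (by rwa [abs_one, mem_ball_zero_iff])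
  rw [← h, integral_arc_eq_circleAverage (fun z => z / (z - w) * f z)]
  simp

theorem continuous_pt_div {w : ℂ} (hw : ‖w‖ < 1) : Continuous fun t => pt t / (pt t - w) :=
  continuous_pt.div (continuous_pt.sub continuous_const) (pt_sub_ne_zero hw)

/-- Cauchy's formula for the dilates `α(r z)`, followed by dominated convergence as `r → 1`. -/
theorem IsInner.integral_bdry (hα : IsInner α) {w : ℂ} (hw : ‖w‖ < 1) :
    ∫ t, pt t / (pt t - w) * bdry α t ∂arc = α w := by
  refine tendsto_nhds_unique (hα.tendsto_integral_radius (continuous_pt_div hw)) ?_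
  have h : ∀ n, ∫ t, pt t / (pt t - w) * α ((radius n : ℂ) * pt t) ∂arc = α ((radius n : ℂ) * w) :=
    fun n => integral_cauchy (hα.diffContOnCl_radius n) hw
  simp only [h]
  have h1 : Tendsto (fun n => (radius n : ℂ) * w) atTop (𝓝 w) := by
    have := (Complex.continuous_ofReal.tendsto 1).comp (tendsto_radius.mono_right nhdsWithin_le_nhds)
    simpa using this.mul_const w
  have h2 : ContinuousAt α w := hα.analytic.continuousOn.continuousAt
    (Metric.isOpen_ball.mem_nhds (mem_ball_zero_iff.mpr hw))
  exact h2.tendsto.comp h1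

theorem IsInner.isHardy_bdry (hα : IsInner α) : IsHardy (bdry α) := by
  refine ⟨hα.memLp_bdry, fun n hn => ?_⟩
  obtain ⟨m, hm⟩ := Int.eq_ofNat_of_zero_le (show 0 ≤ -n by omega)
  have hm0 : m ≠ 0 := by omega
  refine tendsto_nhds_unique (hα.tendsto_integral_radius (fourier (-n)).continuous) ?_
  refine tendsto_const_nhds.congr fun k => ?_
  -- The coefficient of index `-m` of a dilate is the value at `0` of `z^m α(r z)`, which vanishes
  -- as `m > 0`.
  have hd : DiffContOnCl ℂ (fun z => z ^ m * α ((radius k : ℂ) * z)) (Metric.ball 0 1) :=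
    (differentiable_id.pow m).diffContOnCl.smul (hα.diffContOnCl_radius k)
  have h := integral_cauchy hd (w := 0) (by simp)
  rw [zero_pow hm0, zero_mul] at h
  rw [← h]
  refine integral_congr_ae (Eventually.of_forall fun t => ?_)
  simp only [sub_zero, div_self (pt_ne_zero t), one_mul]
  rw [fourier_eq_zpow, hm, zpow_natCast]

/-! ### Point evaluations -/

/-- The value at `w` of the analytic extension of `f` to the disk. -/
noncomputable def evalAt (w : ℂ) (f : Circ → ℂ) : ℂ := ∫ t, pt t / (pt t - w) * f t ∂arc

theorem evalAt_congr {f g : Circ → ℂ} (h : f =ᵐ[arc] g) (w : ℂ) : evalAt w f = evalAt w g := by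
  refine integral_congr_ae ?_
  filter_upwards [h] with t ht
  rw [ht]

theorem integrable_evalAt {f : Circ → ℂ} (hf : MemLp f 2 arc) {w : ℂ} (hw : ‖w‖ < 1) :
    Integrable (fun t => pt t / (pt t - w) * f t) arc :=
  (memLp_continuous_mul (continuous_pt_div hw) hf).integrable one_le_two

theorem evalAt_sub {f g : Circ → ℂ} (hf : MemLp f 2 arc) (hg : MemLp g 2 arc) {w : ℂ}
    (hw : ‖w‖ < 1) : evalAt w (fun t => f t - g t) = evalAt w f - evalAt w g := by
  simp only [evalAt, mul_sub]
  exact integral_sub (integrable_evalAt hf hw) (integrable_evalAt hg hw)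

theorem evalAt_const_mul (w c : ℂ) (f : Circ → ℂ) :
    evalAt w (fun t => c * f t) = c * evalAt w f := by
  simp only [evalAt, mul_left_comm _ c]
  exact integral_const_mul c _

theorem evalAt_const {w : ℂ} (hw : ‖w‖ < 1) (c : ℂ) : evalAt w (fun _ => c) = c :=
  integral_cauchy (f := fun _ => c) diffContOnCl_const hw

theorem integral_eq_fourierCoeff_zero (f : Circ → ℂ) : ∫ t, f t ∂arc = fourierCoeff f 0 := by
  simp [fourierCoeff]

theorem IsHardy.integral_pt_mul {f : Circ → ℂ} (hf : IsHardy f) : ∫ t, pt t * f t ∂arc = 0 := by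
  rw [integral_eq_fourierCoeff_zero, fourierCoeff_pt_mul, hf.2 _ (by norm_num)]

theorem IsHardy.evalAt_pt_sub_mul {f : Circ → ℂ} (hf : IsHardy f) {w : ℂ} (hw : ‖w‖ < 1) :
    evalAt w (fun t => (pt t - w) * f t) = 0 := by
  rw [← hf.integral_pt_mul, evalAt]
  refine integral_congr_ae (Eventually.of_forall fun t => ?_)
  simp only
  rw [← mul_assoc, div_mul_cancel₀ _ (pt_sub_ne_zero hw t)]

theorem IsCoHardy.evalAt_eq_zero {f : Circ → ℂ} (hf : IsCoHardy f) {w : ℂ} (hw : ‖w‖ < 1) :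
    evalAt w f = 0 := by
  have hm := memLp_continuous_mul (continuous_pt_div hw) hf.1
  -- The weight is `1 / (1 - w z̄)`, and dividing by `1 - w z̄` preserves negative spectrum; the
  -- integral is then a zeroth coefficient.
  have h : IsCoHardy fun t => pt t / (pt t - w) * f t := by
    refine IsCoHardy.of_one_sub_conj_mul (c := w) hm hw.le
      (hf.congr (Eventually.of_forall fun t => ?_))
    simp only
    rw [pt_div_pt_sub, ← mul_assoc, mul_one_div_cancel (one_sub_mul_conj_pt_ne_zero hw t), one_mul]
  rw [evalAt, integral_eq_fourierCoeff_zero, h.2 0 le_rfl]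

theorem IsHardy.evalAt_one_sub_mul {f : Circ → ℂ} (hf : IsHardy f) {w : ℂ} (hw : ‖w‖ < 1)
    (c : ℂ) : evalAt w (fun t => (1 - c * pt t) * f t) = (1 - c * w) * evalAt w f := by
  have h : (fun t => (1 - c * pt t) * f t) =
      fun t => (1 - c * w) * f t - c * ((pt t - w) * f t) := by
    funext t; ring
  have hm : MemLp (fun t => (pt t - w) * f t) 2 arc :=
    memLp_continuous_mul (continuous_pt.sub continuous_const) hf.1
  rw [h, evalAt_sub (hf.1.const_mul _) (hm.const_mul c) hw, evalAt_const_mul, evalAt_const_mul,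
    hf.evalAt_pt_sub_mul hw, mul_zero, sub_zero]

/-- The difference quotient of `f` at `w` is again in the Hardy space. -/
theorem IsHardy.div_pt_sub {f : Circ → ℂ} (hf : IsHardy f) {w : ℂ} (hw : ‖w‖ < 1) :
    IsHardy fun t => (f t - evalAt w f) / (pt t - w) := by
  have hs := hf.sub (isHardy_const (evalAt w f))
  have hc : Continuous fun t => 1 / (pt t - w) :=
    continuous_const.div (continuous_pt.sub continuous_const) (pt_sub_ne_zero hw)
  have hm : MemLp (fun t => (f t - evalAt w f) / (pt t - w)) 2 arc := by
    simpa only [one_div_mul_eq_div] using memLp_continuous_mul hc hs.1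
  refine IsHardy.of_pt_sub_mul (w := w) hm (hs.congr (Eventually.of_forall fun t => ?_)) ?_
  · simp only
    rw [mul_div_cancel₀ _ (pt_sub_ne_zero hw t)]
  -- The moment to be killed is the evaluation of `f - f(w)` at `w`.
  · have := evalAt_sub hf.1 (memLp_const (evalAt w f)) hw
    rw [evalAt_const hw, sub_self] at this
    rw [← this, evalAt]
    refine integral_congr_ae (Eventually.of_forall fun t => ?_)
    simp only
    ring

theorem evalAt_zero (f : Circ → ℂ) : evalAt 0 f = fourierCoeff f 0 := by
  rw [← integral_eq_fourierCoeff_zero, evalAt]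
  simp only [sub_zero, div_self (pt_ne_zero _), one_mul]

theorem continuousAt_evalAt_zero {f : Circ → ℂ} (hf : MemLp f 2 arc) :
    ContinuousAt (fun w => evalAt w f) 0 := by
  have hball : ∀ᶠ w : ℂ in 𝓝 0, ‖w‖ < 1 / 2 :=
    Eventually.mono (Metric.ball_mem_nhds (0 : ℂ) one_half_pos) fun w hw => mem_ball_zero_iff.mp hw
  refine continuousAt_of_dominated (bound := fun t => 2 * ‖f t‖) ?_ ?_
    ((hf.integrable one_le_two).norm.const_mul 2) ?_
  · filter_upwards [hball] with w hw
    exact (integrable_evalAt hf (hw.trans (by norm_num))).1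
  · filter_upwards [hball] with w hw
    refine Eventually.of_forall fun t => ?_
    rw [norm_mul, norm_div, norm_pt]
    have h := norm_sub_norm_le (pt t) w
    rw [norm_pt] at h
    gcongr
    rw [div_le_iff₀ (by linarith)]
    linarith
  · refine Eventually.of_forall fun t => ?_
    refine ContinuousAt.mul (continuousAt_const.div (continuousAt_const.sub continuousAt_id) ?_)
      continuousAt_const
    simp

/-- Induction by the backward shift: as `f̂(0) = 0`, `z̄ f` is again in the Hardy space and its
evaluations satisfy `w · (z̄ f)(w) = f(w) = 0`. The point `w = 0` is recovered by continuity. -/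
theorem IsHardy.fourierCoeff_eq_zero_of_evalAt (n : ℕ) {f : Circ → ℂ} (hf : IsHardy f)
    (h : ∀ w : ℂ, ‖w‖ < 1 → evalAt w f = 0) : fourierCoeff f n = 0 := by
  have h0 : fourierCoeff f 0 = 0 := by rw [← evalAt_zero, h 0 (by simp)]
  induction n generalizing f with
  | zero => exact h0
  | succ n ih =>
    have hm : MemLp (fun t => conj (pt t) * f t) 2 arc :=
      memLp_continuous_mul (Complex.continuous_conj.comp continuous_pt) hf.1
    have hg : IsHardy fun t => conj (pt t) * f t := by
      refine ⟨hm, fun k hk => ?_⟩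
      rw [fourierCoeff_conj_pt_mul]
      rcases (show k + 1 < 0 ∨ k + 1 = 0 by omega) with h' | h'
      · exact hf.2 _ h'
      · rw [h', h0]
    have hne : ∀ w : ℂ, ‖w‖ < 1 → w ≠ 0 → evalAt w (fun t => conj (pt t) * f t) = 0 := by
      intro w hw hw0
      have h1 := hg.evalAt_pt_sub_mul hw
      have e : (fun t => (pt t - w) * (conj (pt t) * f t)) =
          fun t => f t - w * (conj (pt t) * f t) := by
        funext t
        linear_combination f t * pt_mul_conj t
      rw [e, evalAt_sub hf.1 (hm.const_mul w) hw, evalAt_const_mul, h w hw, zero_sub,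
        neg_eq_zero] at h1
      exact (mul_eq_zero.mp h1).resolve_left hw0
    have hz : evalAt 0 (fun t => conj (pt t) * f t) = 0 := by
      have hc := (continuousAt_evalAt_zero hm).tendsto.mono_left (nhdsWithin_le_nhds (s := {0}ᶜ))
      refine tendsto_nhds_unique hc (tendsto_const_nhds.congr' ?_)
      filter_upwards [self_mem_nhdsWithin, nhdsWithin_le_nhds (Metric.ball_mem_nhds (0 : ℂ) one_pos)]
        with w hw0 hw
      exact (hne w (mem_ball_zero_iff.mp hw) hw0).symm
    have hall : ∀ w : ℂ, ‖w‖ < 1 → evalAt w (fun t => conj (pt t) * f t) = 0 := by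
      intro w hw
      by_cases hw0 : w = 0
      · rw [hw0, hz]
      · exact hne w hw hw0
    have := ih hg hall (by rw [← evalAt_zero, hz])
    rw [fourierCoeff_conj_pt_mul] at this
    exact_mod_cast this

theorem IsHardy.eq_zero_of_evalAt {f : L2} (hf : IsHardy f)
    (h : ∀ w : ℂ, ‖w‖ < 1 → evalAt w f = 0) : f = 0 := by
  refine (fourierBasis (T := 1)).repr.injective ?_
  ext n
  rw [fourierBasis_repr, map_zero, lp.coeFn_zero, Pi.zero_apply]
  rcases lt_or_ge n 0 with hn | hn
  · exact hf.2 n hn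
  · obtain ⟨k, rfl⟩ := Int.eq_ofNat_of_zero_le hn
    exact hf.fourierCoeff_eq_zero_of_evalAt k h

attribute [local instance high] InnerProductSpace.toInner

/-! ### Model spaces -/

theorem mem_hardy_iff {f : L2} : f ∈ hardy ↔ IsHardy f :=
  ⟨fun h => ⟨Lp.memLp f, h⟩, fun h => h.2⟩

theorem IsHardy.toLp_mem {f : Circ → ℂ} (hf : IsHardy f) : hf.memLp.toLp f ∈ hardy :=
  mem_hardy_iff.mpr (hf.congr hf.memLp.coeFn_toLp.symm)

theorem IsInner.memLp_conj_mul (hα : IsInner α) {f : Circ → ℂ} (hf : MemLp f 2 arc) :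
    MemLp (fun t => conj (bdry α t) * f t) 2 arc :=
  memLp_bdd_mul (C := 1) hα.aestronglyMeasurable_bdry.star
    (hα.norm_bdry_le.mono fun t ht => by rwa [RCLike.norm_conj]) hf

/-- Testing `f` against `α z^n`, `n ≥ 0`, produces the nonnegative coefficients of `ᾱ f`. -/
theorem IsInner.mem_modelSpace_iff (hα : IsInner α) {f : L2} :
    f ∈ modelSpace α ↔ IsHardy f ∧ IsCoHardy fun t => conj (bdry α t) * f t := by
  rw [modelSpace, Submodule.mem_inf, mem_hardy_iff, Submodule.mem_orthogonal]
  refine and_congr_right fun hf => ⟨fun h => ⟨hα.memLp_conj_mul hf.1, fun n hn => ?_⟩,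
    fun h g ⟨k, hk, hg⟩ => ?_⟩
  · have hm : MemLp (fun t => bdry α t * (fourier n t : ℂ)) 2 arc :=
      memLp_bdd_mul hα.aestronglyMeasurable_bdry hα.norm_bdry_le (isHardy_fourier hn).1
    have h1 := h (hm.toLp _) ⟨_, (isHardy_fourier hn).toLp_mem, by
      filter_upwards [hm.coeFn_toLp, (isHardy_fourier hn).memLp.coeFn_toLp] with t h1 h2
      rw [h1, h2]⟩
    rw [inner_eq_integral hm.coeFn_toLp EventuallyEq.rfl] at h1
    rw [← h1, fourierCoeff]
    refine integral_congr_ae (Eventually.of_forall fun t => ?_)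
    simp only [map_mul, conj_fourier, smul_eq_mul]
    ring
  · rw [inner_eq_integral hg EventuallyEq.rfl, ← (mem_hardy_iff.mp hk).integral_conj_mul h]
    refine integral_congr_ae (Eventually.of_forall fun t => ?_)
    simp only [map_mul]
    ring

theorem IsInner.isHardy_coe (hα : IsInner α) (f : modelSpace α) : IsHardy (f : L2) :=
  (hα.mem_modelSpace_iff.mp f.2).1

theorem IsInner.isCoHardy_conj_mul (hα : IsInner α) (f : modelSpace α) :
    IsCoHardy fun t => conj (bdry α t) * (f : L2) t :=
  (hα.mem_modelSpace_iff.mp f.2).2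

theorem IsInner.exists_modelSpace (hα : IsInner α) {f : Circ → ℂ} (hf : IsHardy f)
    (hf' : IsCoHardy fun t => conj (bdry α t) * f t) :
    ∃ k : modelSpace α, ((k : L2) : Circ → ℂ) =ᵐ[arc] f := by
  have h := hf.memLp.coeFn_toLp
  refine ⟨⟨hf.memLp.toLp f, hα.mem_modelSpace_iff.mpr ⟨hf.congr h.symm, hf'.congr ?_⟩⟩, h⟩
  filter_upwards [h] with t ht
  rw [ht]

/-! ### Reproducing kernels -/

theorem ae_one_sub_conj_mul_pt_ne_zero (w : ℂ) : ∀ᵐ t ∂arc, 1 - conj w * pt t ≠ 0 := by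
  filter_upwards [ae_pt_ne w] with t ht
  rw [one_sub_conj_mul_pt]
  exact mul_ne_zero ((map_ne_zero _).mpr (sub_ne_zero.mpr ht)) (pt_ne_zero t)

theorem one_sub_mul_kernel {w : ℂ} {t : Circ} (h : 1 - conj w * pt t ≠ 0) (a : ℂ) :
    (1 - conj w * pt t) * kernel α w a t = 1 - conj a * bdry α t :=
  mul_div_cancel₀ _ h

/-- Uses only `|α| = |z| = 1`, so it holds for any `w` and `a`. It reduces membership of kernels in
the model space to the difference quotient of `α` being in the Hardy space. -/
theorem IsInner.conj_bdry_mul_kernel (hα : IsInner α) (w a : ℂ) : ∀ᵐ t ∂arc,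
    conj (bdry α t) * kernel α w a t = conj (pt t * ((bdry α t - a) / (pt t - w))) := by
  filter_upwards [hα.bdry_mul_conj, ae_pt_ne w] with t h1 h2
  have h3 : conj (pt t - w) ≠ 0 := (map_ne_zero _).mpr (sub_ne_zero.mpr h2)
  rw [kernel, one_sub_conj_mul_pt, map_mul, map_div₀, mul_div_assoc', mul_div_assoc',
    div_eq_div_iff (mul_ne_zero h3 (pt_ne_zero t)) h3, map_sub conj (bdry α t)]
  linear_combination (-(conj a) * conj (pt t - w)) * h1 -
    (conj (pt t - w) * (conj (bdry α t) - conj a)) * pt_mul_conj t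

theorem IsInner.kernel_eq (hα : IsInner α) (w a : ℂ) : ∀ᵐ t ∂arc,
    kernel α w a t = bdry α t * conj (pt t * ((bdry α t - a) / (pt t - w))) := by
  filter_upwards [hα.bdry_mul_conj, hα.conj_bdry_mul_kernel w a] with t h1 h2
  rw [← h2, ← mul_assoc, h1, one_mul]

/-- If the difference quotient of `α` at `w` is in the Hardy space, the kernel at `w` is in the
model space. -/
theorem IsInner.exists_kernel (hα : IsInner α) {w a : ℂ} (hw : ‖w‖ ≤ 1)
    (hF : IsHardy fun t => (bdry α t - a) / (pt t - w)) :
    ∃ k : modelSpace α, ((k : L2) : Circ → ℂ) =ᵐ[arc] kernel α w a := by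
  have hm : MemLp (kernel α w a) 2 arc := by
    refine (memLp_congr_ae (hα.kernel_eq w a)).mpr ?_
    exact memLp_bdd_mul hα.aestronglyMeasurable_bdry hα.norm_bdry_le hF.conj_pt_mul.memLp
  refine hα.exists_modelSpace ?_ (hF.conj_pt_mul.congr (hα.conj_bdry_mul_kernel w a |>.mono
    fun t ht => ht.symm))
  refine IsHardy.of_one_sub_mul (c := conj w) hm (by rwa [RCLike.norm_conj]) ?_
  refine ((isHardy_const 1).sub (hα.isHardy_bdry.const_mul (conj a))).congr ?_
  filter_upwards [ae_one_sub_conj_mul_pt_ne_zero w] with t ht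
  rw [one_sub_mul_kernel ht]

theorem IsInner.isHardy_diffQuot (hα : IsInner α) {w : ℂ} (hw : ‖w‖ < 1) :
    IsHardy fun t => (bdry α t - α w) / (pt t - w) := by
  have h := hα.isHardy_bdry.div_pt_sub hw
  rwa [show evalAt w (bdry α) = α w from hα.integral_bdry hw] at h

/-- The conjugation `C_α` exchanges the two spectral conditions that define `K_α`. -/
theorem IsInner.exists_conjKernel (hα : IsInner α) {w : ℂ} (hw : ‖w‖ < 1) :
    ∃ k : modelSpace α, ((k : L2) : Circ → ℂ) =ᵐ[arc] conjKernel α w := by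
  obtain ⟨k, hk⟩ := hα.exists_kernel hw.le (hα.isHardy_diffQuot hw)
  refine hα.exists_modelSpace ((hα.isHardy_diffQuot hw).congr ?_)
    ((hα.isHardy_coe k).conj_pt_mul.congr ?_)
  · filter_upwards [hα.norm_bdry] with t ht
    rw [conjKernel_eq ht]
  · filter_upwards [hα.bdry_mul_conj, hk] with t h1 h2
    rw [h2, conjKernel, conjugation, map_mul]
    linear_combination (-conj (pt t) * conj (kernel α w (α w) t)) * h1

theorem memLp_kernel_mul (hα : IsInner α) {w : ℂ} (hw : ‖w‖ < 1) (a : ℂ) {g : Circ → ℂ}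
    (hg : MemLp g 2 arc) : MemLp (fun t => kernel α w a t * g t) 2 arc := by
  have hc : Continuous fun t => 1 / (1 - conj w * pt t) :=
    continuous_const.div (continuous_const.sub (continuous_const.mul continuous_pt))
      (one_sub_conj_mul_pt_ne_zero hw)
  have h1 := memLp_continuous_mul hc hg
  have h2 := h1.sub
    ((memLp_bdd_mul hα.aestronglyMeasurable_bdry hα.norm_bdry_le h1).const_mul (conj a))
  refine (memLp_congr_ae (Eventually.of_forall fun t => ?_)).mp h2
  simp only [kernel, Pi.sub_apply]
  ring

/-- The reproducing property of the kernels. -/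
theorem IsInner.inner_kernel (hα : IsInner α) {w : ℂ} (hw : ‖w‖ < 1) {k : modelSpace α}
    (hk : ((k : L2) : Circ → ℂ) =ᵐ[arc] kernel α w (α w)) (f : modelSpace α) :
    inner ℂ k f = evalAt w (f : L2) := by
  -- The pairing with `k_w` is the evaluation at `w` of `f - α(w) ᾱ f`, whose second term
  -- contributes nothing because its spectrum is negative.
  have h := evalAt_sub (hα.isHardy_coe f).1 ((hα.isCoHardy_conj_mul f).1.const_mul (α w)) hw
  rw [evalAt_const_mul, (hα.isCoHardy_conj_mul f).evalAt_eq_zero hw, mul_zero, sub_zero] at h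
  rw [← h, Submodule.coe_inner, inner_eq_integral hk EventuallyEq.rfl, evalAt]
  refine integral_congr_ae (Eventually.of_forall fun t => ?_)
  simp only [pt_div_pt_sub, kernel, map_div₀, map_sub, map_mul, map_one, Complex.conj_conj]
  ring

theorem IsInner.evalAt_kernel (hα : IsInner α) {u : ℂ} (hu : ‖u‖ < 1) {w a : ℂ}
    {k : modelSpace α} (hk : ((k : L2) : Circ → ℂ) =ᵐ[arc] kernel α w a) :
    (1 - conj w * u) * evalAt u (k : L2) = 1 - conj a * α u := by
  rw [← (hα.isHardy_coe k).evalAt_one_sub_mul hu]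
  have h : (fun t => (1 - conj w * pt t) * (k : L2) t) =ᵐ[arc]
      fun t => 1 - conj a * bdry α t := by
    filter_upwards [hk, ae_one_sub_conj_mul_pt_ne_zero w] with t h1 h2
    rw [h1, one_sub_mul_kernel h2]
  rw [evalAt_congr h, evalAt_sub (memLp_const 1) (hα.memLp_bdry.const_mul _) hu,
    evalAt_const hu, evalAt_const_mul, show evalAt u (bdry α) = α u from hα.integral_bdry hu]

theorem IsInner.eq_zero_of_inner_kernel (hα : IsInner α) (f : modelSpace α)
    (h : ∀ (w : ℂ) (k : modelSpace α), ‖w‖ < 1 →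
      ((k : L2) : Circ → ℂ) =ᵐ[arc] kernel α w (α w) → inner ℂ k f = 0) : f = 0 := by
  refine Subtype.ext ((hα.isHardy_coe f).eq_zero_of_evalAt fun w hw => ?_)
  obtain ⟨k, hk⟩ := hα.exists_kernel hw.le (hα.isHardy_diffQuot hw)
  rw [← hα.inner_kernel hw hk, h w k hw hk]

/-! ### Toeplitz operators -/

theorem IsInner.orthogonalProjectionOnto_eq (hβ : IsInner β) {ψ h R : Circ → ℂ}
    (hψ : MemLp ψ 2 arc) (k : modelSpace β) (hh : IsHardy h) (hR : IsCoHardy R)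
    (e : ψ =ᵐ[arc] fun t => (k : L2) t + bdry β t * h t + R t) :
    (modelSpace β).orthogonalProjectionOnto (hψ.toLp ψ) = k := by
  refine ext_inner_left ℂ fun u => ?_
  have hu := hβ.isHardy_coe u
  have h1 := hh.integral_conj_mul (hβ.isCoHardy_conj_mul u)
  have h1' := congrArg conj h1
  rw [← integral_conj, map_zero] at h1'
  have hm : MemLp (fun t => bdry β t * h t) 2 arc :=
    memLp_bdd_mul hβ.aestronglyMeasurable_bdry hβ.norm_bdry_le hh.1
  rw [Submodule.inner_orthogonalProjectionOnto_eq_of_mem_left, Submodule.coe_inner,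
    inner_eq_integral EventuallyEq.rfl (hψ.coeFn_toLp.trans e),
    inner_eq_integral EventuallyEq.rfl EventuallyEq.rfl]
  have i1 := integrable_conj_mul hu.1 (hβ.isHardy_coe k).1
  have i2 := integrable_conj_mul hu.1 hm
  have i3 := integrable_conj_mul hu.1 hR.1
  have e2 : ∫ t, conj ((u : L2) t) * (bdry β t * h t) ∂arc = 0 := by
    rw [← h1']
    refine integral_congr_ae (Eventually.of_forall fun t => ?_)
    simp only [map_mul, Complex.conj_conj]
    ring
  simp only [mul_add]
  have i12 : Integrable (fun t => conj ((u : L2) t) * (k : L2) t +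
      conj ((u : L2) t) * (bdry β t * h t)) arc := i1.add i2
  rw [integral_add i12 i3, integral_add i1 i2, e2, hu.integral_conj_mul hR, add_zero,
    add_zero]

/-- The formal adjoint of `A_φ^{α,β}` is the operator from `K_β` to `K_α` with symbol `φ̄`. -/
theorem inner_orthogonalProjectionOnto_mul {φ : Circ → ℂ} (f : modelSpace α) (g : modelSpace β)
    (hf : MemLp (fun t => φ t * (f : L2) t) 2 arc)
    (hg : MemLp (fun t => conj (φ t) * (g : L2) t) 2 arc) :
    inner ℂ g ((modelSpace β).orthogonalProjectionOnto (hf.toLp _)) =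
      inner ℂ ((modelSpace α).orthogonalProjectionOnto (hg.toLp _)) f := by
  rw [Submodule.inner_orthogonalProjectionOnto_eq_of_mem_left,
    Submodule.inner_orthogonalProjectionOnto_eq_of_mem_right,
    inner_eq_integral EventuallyEq.rfl hf.coeFn_toLp,
    inner_eq_integral hg.coeFn_toLp EventuallyEq.rfl]
  refine integral_congr_ae (Eventually.of_forall fun t => ?_)
  simp only [map_mul, Complex.conj_conj]
  ring

theorem isToeplitz_of_memLp_mul {T : modelSpace α →L[ℂ] modelSpace β} {φ : Circ → ℂ}
    (hφ : ∀ g : Circ → ℂ, MemLp g 2 arc → MemLp (fun t => φ t * g t) 2 arc)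
    (h : ∀ f : modelSpace α, ∀ hf : MemLp (fun t => φ t * (f : L2) t) 2 arc,
      (modelSpace β).orthogonalProjectionOnto (hf.toLp _) = T f) : IsToeplitz T φ where
  memLp := by simpa using hφ _ (memLp_const 1)
  dense := by
    have : (toeplitz α β φ).domain = ⊤ :=
      eq_top_iff.mpr fun f _ => hφ _ (Lp.memLp (f : L2))
    rw [this]
    exact dense_univ
  eq f := h f f.2

theorem memLp_bdry_div_mul (hβ : IsInner β) {w : ℂ} (hw : ‖w‖ < 1) {g : Circ → ℂ}
    (hg : MemLp g 2 arc) : MemLp (fun t => bdry β t / (pt t - w) * g t) 2 arc := by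
  have hc : Continuous fun t => 1 / (pt t - w) :=
    continuous_const.div (continuous_pt.sub continuous_const) (pt_sub_ne_zero hw)
  convert memLp_bdd_mul hβ.aestronglyMeasurable_bdry hβ.norm_bdry_le
    (memLp_continuous_mul hc hg) using 2 with t
  ring

theorem isCoHardy_one_div_pt_sub {w : ℂ} (hw : ‖w‖ < 1) :
    IsCoHardy fun t => 1 / (pt t - w) := by
  have hc : Continuous fun t => 1 / (pt t - w) :=
    continuous_const.div (continuous_pt.sub continuous_const) (pt_sub_ne_zero hw)
  refine IsCoHardy.of_one_sub_conj_mul (c := w) (memLp_continuous hc) hw.le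
    ((isHardy_const 1).conj_pt_mul.congr (Eventually.of_forall fun t => ?_))
  simp only [mul_one]
  rw [one_sub_mul_conj_pt, mul_one_div, mul_div_cancel_left₀ _ (pt_sub_ne_zero hw t)]

theorem orthogonalProjectionOnto_bdry_div (hα : IsInner α) (hβ : IsInner β) {w : ℂ}
    (hw : ‖w‖ < 1) {kα : modelSpace α} {kβ' : modelSpace β}
    (hkα : ((kα : L2) : Circ → ℂ) =ᵐ[arc] kernel α w (α w))
    (hkβ' : ((kβ' : L2) : Circ → ℂ) =ᵐ[arc] conjKernel β w) (f : modelSpace α)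
    (hf : MemLp (fun t => bdry β t / (pt t - w) * (f : L2) t) 2 arc) :
    (modelSpace β).orthogonalProjectionOnto (hf.toLp _) = rankOne ℂ kβ' kα f := by
  rw [rankOne_apply, hα.inner_kernel hw hkα]
  refine hβ.orthogonalProjectionOnto_eq hf _ ((hα.isHardy_coe f).div_pt_sub hw)
    ((isCoHardy_one_div_pt_sub hw).const_mul (evalAt w (f : L2) * β w)) ?_
  filter_upwards [hkβ', hβ.norm_bdry, Lp.coeFn_smul (evalAt w (f : L2)) (kβ' : L2)]
    with t h1 h2 h3
  rw [Submodule.coe_smul, h3, Pi.smul_apply, h1, conjKernel_eq h2, smul_eq_mul]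
  ring

theorem isToeplitz_conjKernel_kernel (hα : IsInner α) (hβ : IsInner β) {w : ℂ}
    (hw : ‖w‖ < 1) {kα : modelSpace α} {kβ' : modelSpace β}
    (hkα : ((kα : L2) : Circ → ℂ) =ᵐ[arc] kernel α w (α w))
    (hkβ' : ((kβ' : L2) : Circ → ℂ) =ᵐ[arc] conjKernel β w) :
    IsToeplitz (rankOne ℂ kβ' kα) fun t => bdry β t / (pt t - w) :=
  isToeplitz_of_memLp_mul (fun _ hg => memLp_bdry_div_mul hβ hw hg) fun f hf =>
    orthogonalProjectionOnto_bdry_div hα hβ hw hkα hkβ' f hf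

theorem isToeplitz_kernel_conjKernel (hα : IsInner α) (hβ : IsInner β) {w : ℂ}
    (hw : ‖w‖ < 1) {kα' : modelSpace α} {kβ : modelSpace β}
    (hkα' : ((kα' : L2) : Circ → ℂ) =ᵐ[arc] conjKernel α w)
    (hkβ : ((kβ : L2) : Circ → ℂ) =ᵐ[arc] kernel β w (β w)) :
    IsToeplitz (rankOne ℂ kβ kα') fun t => conj (bdry α t) / (conj (pt t) - conj w) := by
  refine isToeplitz_of_memLp_mul (fun g hg => ?_) fun f hf => ext_inner_left ℂ fun g => ?_
  · convert memLp_conj (memLp_bdry_div_mul hα hw (memLp_conj hg)) using 2 with t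
    simp
  · have e : (fun t => conj (conj (bdry α t) / (conj (pt t) - conj w)) * (g : L2) t) =
        fun t => bdry α t / (pt t - w) * (g : L2) t := by
      funext t; simp
    have hg := memLp_bdry_div_mul hα hw (Lp.memLp (g : L2))
    have h := orthogonalProjectionOnto_bdry_div hβ hα hw hkβ hkα' g hg
    rw [inner_orthogonalProjectionOnto_mul f g hf (by rwa [e])]
    simp only [e]
    rw [h, rankOne_apply, rankOne_apply, inner_smul_left, inner_smul_right, inner_conj_symm,
      mul_comm]

/-! ### Kernels at boundary points -/

/-- With `c = ⟨f, k_η^α⟩` in the role of `f(η)` and `F = (f - c) / (z - η)`, the product of symbol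
and `f` is `c k_η^β + β · (η b̄ F) + R`, where `R = (conj k_η^α - 1) f - η F`. -/
theorem orthogonalProjectionOnto_boundary_symbol (hα : IsInner α) (hβ : IsInner β) {η a b : ℂ}
    (hη : ‖η‖ = 1) (hF : IsHardy fun t => (bdry α t - a) / (pt t - η))
    {kα : modelSpace α} {kβ : modelSpace β}
    (hkα : ((kα : L2) : Circ → ℂ) =ᵐ[arc] kernel α η a)
    (hkβ : ((kβ : L2) : Circ → ℂ) =ᵐ[arc] kernel β η b)
    {u : ℂ} (hu : ‖u‖ < 1) {f : modelSpace α}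
    (hf : ((f : L2) : Circ → ℂ) =ᵐ[arc] kernel α u (α u))
    (hm : MemLp (fun t => (kernel β η b t + conj (kernel α η a t) - 1) * (f : L2) t) 2 arc) :
    (modelSpace β).orthogonalProjectionOnto (hm.toLp _) = rankOne ℂ kβ kα f := by
  have hηη : conj η * η = 1 := by rw [Complex.conj_mul', hη]; norm_num
  have hne : 1 - conj u * η ≠ 0 := by
    intro h
    have h1 := congrArg norm (sub_eq_zero.mp h)
    rw [norm_mul, RCLike.norm_conj, hη, mul_one, norm_one] at h1
    exact hu.ne h1.symm
  obtain ⟨c, hc⟩ : ∃ c, c = inner ℂ kα f := ⟨_, rfl⟩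
  have hc' : (1 - conj u * η) * c = 1 - conj (α u) * a := by
    have h := congrArg conj (hα.evalAt_kernel hu hkα)
    rw [← hα.inner_kernel hu hf, map_mul, inner_conj_symm, ← hc] at h
    simpa [mul_comm] using h
  rw [rankOne_apply, ← hc]
  -- the difference quotient of `f` at `η`
  have hinv : Continuous fun t => 1 / (1 - conj u * pt t) :=
    continuous_const.div (continuous_const.sub (continuous_const.mul continuous_pt))
      (one_sub_conj_mul_pt_ne_zero hu)
  -- This form of `(f - c) / (z - η)` comes from `hc'`; it shows that `F` inherits square
  -- integrability from the difference quotient of `α`.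
  set F : Circ → ℂ := fun t => 1 / (1 - conj u * pt t) *
      (conj u * c - conj (α u) * ((bdry α t - a) / (pt t - η))) with hFdef
  have hF1 := (isHardy_const (conj u * c)).sub (hF.const_mul (conj (α u)))
  have hFh : IsHardy F := by
    refine IsHardy.of_one_sub_mul (c := conj u) (memLp_continuous_mul hinv hF1.1)
      (by rw [RCLike.norm_conj]; exact hu.le) (hF1.congr (Eventually.of_forall fun t => ?_))
    simp only [hFdef]
    rw [← mul_assoc, mul_one_div_cancel (one_sub_conj_mul_pt_ne_zero hu t), one_mul]
  have hFf : ∀ᵐ t ∂arc, (f : L2) t = c + (pt t - η) * F t := by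
    filter_upwards [hf, ae_pt_ne η] with t h1 h2
    have h3 := sub_ne_zero.mpr h2
    have h4 := one_sub_conj_mul_pt_ne_zero hu t
    have h5 : (pt t - η) * ((bdry α t - a) / (pt t - η)) = bdry α t - a := mul_div_cancel₀ _ h3
    have h6 : (1 - conj u * pt t) * F t =
        conj u * c - conj (α u) * ((bdry α t - a) / (pt t - η)) := by
      simp only [hFdef]
      rw [← mul_assoc, mul_one_div_cancel h4, one_mul]
    rw [h1, kernel, div_eq_iff h4]
    linear_combination -hc' - (pt t - η) * h6 + conj (α u) * h5
  have hmα : MemLp (fun t => (conj (kernel α η a t) - 1) * (f : L2) t) 2 arc := by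
    have h1 : MemLp (fun t => conj ((kα : L2) t) - 1) 2 arc :=
      (memLp_conj (Lp.memLp (kα : L2))).sub (memLp_const 1)
    refine (memLp_congr_ae ?_).mp (memLp_kernel_mul hα hu (α u) h1)
    filter_upwards [hf, hkα] with t h2 h3
    rw [h2, h3, mul_comm]
  -- Multiplied by `1 - η z̄`, the remainder collapses to `η c z̄ - a ᾱ f`, and both terms have
  -- negative spectrum.
  have hR : IsCoHardy fun t => (conj (kernel α η a t) - 1) * (f : L2) t - η * F t := by
    refine IsCoHardy.of_one_sub_conj_mul (c := η) (hmα.sub (hFh.1.const_mul η)) hη.le ?_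
    refine (((isHardy_const (conj (η * c))).conj_pt_mul).sub
      ((hα.isCoHardy_conj_mul f).const_mul a)).congr ?_
    filter_upwards [hFf, ae_one_sub_conj_mul_pt_ne_zero η] with t h1 h2
    have h3 := congrArg conj (one_sub_mul_kernel (α := α) h2 a)
    simp only [map_mul, map_sub, map_one, Complex.conj_conj] at h3 ⊢
    linear_combination (-(f : L2) t) * h3 + η * conj (pt t) * (-h1) -
      η * F t * pt_mul_conj t
  refine hβ.orthogonalProjectionOnto_eq hm _ (hFh.const_mul (η * conj b)) hR ?_
  filter_upwards [hkβ, hFf, ae_one_sub_conj_mul_pt_ne_zero η, Lp.coeFn_smul c (kβ : L2)]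
    with t h1 h2 h3 h4
  have h5 := one_sub_mul_kernel (α := β) h3 b
  rw [Submodule.coe_smul, h4, Pi.smul_apply, h1, smul_eq_mul]
  linear_combination kernel β η b t * h2 - η * F t * h5 -
    F t * kernel β η b t * pt t * hηη

theorem isToeplitz_boundary_kernels (hα : IsInner α) (hβ : IsInner β) {η a b : ℂ}
    (hη : ‖η‖ = 1) (hFβ : IsHardy fun t => (bdry β t - b) / (pt t - η))
    {kα : modelSpace α} {kβ : modelSpace β}
    (hkα : ((kα : L2) : Circ → ℂ) =ᵐ[arc] kernel α η a)
    (hkβ : ((kβ : L2) : Circ → ℂ) =ᵐ[arc] kernel β η b) :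
    IsToeplitz (rankOne ℂ kβ kα) fun t => kernel β η b t + conj (kernel α η a t) - 1 := by
  have hmem : ∀ {α β : ℂ → ℂ} {a b : ℂ} {kα : modelSpace α} {kβ : modelSpace β},
      ((kα : L2) : Circ → ℂ) =ᵐ[arc] kernel α η a → ((kβ : L2) : Circ → ℂ) =ᵐ[arc] kernel β η b →
      MemLp (fun t => kernel β η b t + conj (kernel α η a t) - 1) 2 arc := by
    intro α β a b kα kβ hkα hkβ
    have h1 := (memLp_congr_ae hkα).mp (Lp.memLp (kα : L2))
    have h2 := (memLp_congr_ae hkβ).mp (Lp.memLp (kβ : L2))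
    exact (h2.add (memLp_conj h1)).sub (memLp_const 1)
  have hdom : ∀ {α : ℂ → ℂ}, IsInner α → ∀ {φ : Circ → ℂ}, MemLp φ 2 arc →
      ∀ {u : ℂ} {f : modelSpace α}, ‖u‖ < 1 → ((f : L2) : Circ → ℂ) =ᵐ[arc] kernel α u (α u) →
      MemLp (fun t => φ t * (f : L2) t) 2 arc := by
    intro α hα φ hφ u f hu hf
    refine (memLp_congr_ae ?_).mp (memLp_kernel_mul hα hu (α u) hφ)
    filter_upwards [hf] with t ht
    rw [ht, mul_comm]
  refine ⟨hmem hkα hkβ, ?_, fun f => ?_⟩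
  -- The domain contains every `k_w`, `|w| < 1`, as these are bounded, and only zero is orthogonal
  -- to all of them.
  · rw [Submodule.dense_iff_topologicalClosure_eq_top, Submodule.topologicalClosure_eq_top_iff,
      eq_bot_iff]
    intro f hf
    refine (Submodule.mem_bot ℂ).mpr (hα.eq_zero_of_inner_kernel f fun w k hw hk => ?_)
    exact hf k (hdom hα (hmem hkα hkβ) hw hk)
  -- A general `f` in the domain is out of reach of the decomposition, so both sides are paired with
  -- kernels `g` of `K_β` and the decomposition is applied to `g`, with `α` and `β` exchanged.
  · refine sub_eq_zero.mp (hβ.eq_zero_of_inner_kernel _ fun w g hw hg => ?_)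
    have e : (fun t => conj (kernel β η b t + conj (kernel α η a t) - 1) * (g : L2) t) =
        fun t => (kernel α η a t + conj (kernel β η b t) - 1) * (g : L2) t := by
      funext t
      simp only [map_sub, map_add, map_one, Complex.conj_conj]
      ring
    have hgm := hdom hβ (hmem hkβ hkα) hw hg
    have h := orthogonalProjectionOnto_boundary_symbol hβ hα hη hFβ hkβ hkα hw hg hgm
    have h2 := inner_orthogonalProjectionOnto_mul (f : modelSpace α) g f.2 (by rwa [e])
    simp only [e] at h2
    rw [h] at h2
    rw [inner_sub_right, sub_eq_zero]
    refine h2.trans ?_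
    rw [rankOne_apply, rankOne_apply, inner_smul_left, inner_smul_right, inner_conj_symm, mul_comm]

/-! ### Angular derivatives -/

theorem IsInner.norm_sq_kernel (hα : IsInner α) {w : ℂ} (hw : ‖w‖ < 1) {k : modelSpace α}
    (hk : ((k : L2) : Circ → ℂ) =ᵐ[arc] kernel α w (α w)) :
    (1 - ‖w‖ ^ 2) * ‖k‖ ^ 2 = 1 - ‖α w‖ ^ 2 := by
  have h := hα.evalAt_kernel hw hk
  rw [← hα.inner_kernel hw hk, inner_self_eq_norm_sq_to_K, Complex.conj_mul',
    Complex.conj_mul'] at h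
  refine Complex.ofReal_injective ?_
  push_cast
  exact h

theorem IsInner.eLpNorm_diffQuot (hα : IsInner α) {w : ℂ} {a : ℂ} {k : modelSpace α}
    (hk : ((k : L2) : Circ → ℂ) =ᵐ[arc] kernel α w a) :
    eLpNorm (fun t => (bdry α t - a) / (pt t - w)) 2 arc = ENNReal.ofReal ‖k‖ := by
  rw [Submodule.coe_norm, ofReal_norm, Lp.enorm_def]
  refine eLpNorm_congr_norm_ae ?_
  filter_upwards [hk, hα.kernel_eq w a, hα.norm_bdry] with t h1 h2 h3
  rw [h1, h2, norm_mul, h3, RCLike.norm_conj, norm_mul, norm_pt, one_mul, one_mul]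

theorem tendsto_radial {η : ℂ} (hη : ‖η‖ = 1) : Tendsto (fun r : ℝ => (r : ℂ) * η) (𝓝[<] 1)
    (𝓝[{z : ℂ | ‖z‖ < 1 ∧ ‖z - η‖ ≤ 1 * (1 - ‖z‖)}] η) := by
  refine tendsto_nhdsWithin_iff.mpr ⟨?_, ?_⟩
  · have : Tendsto (fun r : ℝ => (r : ℂ) * η) (𝓝 1) (𝓝 (((1 : ℝ) : ℂ) * η)) :=
      ((Complex.continuous_ofReal.tendsto 1).mul_const η)
    rw [Complex.ofReal_one, one_mul] at this
    exact this.mono_left nhdsWithin_le_nhds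
  · filter_upwards [Ioo_mem_nhdsLT (show (0 : ℝ) < 1 by norm_num)] with r hr
    have h1 : ‖(r : ℂ) * η‖ = r := by
      rw [norm_mul, hη, mul_one, Complex.norm_real, Real.norm_of_nonneg hr.1.le]
    have h2 : ‖(r : ℂ) * η - η‖ = 1 - r := by
      rw [← sub_one_mul, norm_mul, hη, mul_one, ← Complex.ofReal_one, ← Complex.ofReal_sub,
        Complex.norm_real, Real.norm_of_nonpos (by linarith [hr.2]), neg_sub]
    refine ⟨?_, ?_⟩
    · rw [h1]; exact hr.2
    · rw [h1, h2, one_mul]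

theorem HasADC.tendsto_radial {η a : ℂ} (h : HasADC α η a) (hη : ‖η‖ = 1) :
    Tendsto (fun r : ℝ => α ((r : ℂ) * η)) (𝓝[<] 1) (𝓝 a) :=
  (h.limit 1 one_pos).comp (ModelSpaces.tendsto_radial hη)

/-- Mean value inequality between `rη` and `sη`, where `|α'| ≤ |a'| + 1`, followed by `s → 1`. -/
theorem HasADC.exists_radial_bound {η a : ℂ} (hα : IsInner α) (h : HasADC α η a)
    (hη : ‖η‖ = 1) :
    ∃ M : ℝ, ∀ᶠ r : ℝ in 𝓝[<] 1, ‖α ((r : ℂ) * η) - a‖ ≤ M * (1 - r) := by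
  obtain ⟨a', ha'⟩ := h.deriv_limit
  have h1 := ((ha' 1 one_pos).comp (ModelSpaces.tendsto_radial hη)).norm
  have h2 := h1.eventually (gt_mem_nhds (show ‖a'‖ < ‖a'‖ + 1 by linarith))
  obtain ⟨l, hl, hl'⟩ := (mem_nhdsLT_iff_exists_Ioo_subset' (show (0 : ℝ) < 1 by norm_num)).mp
    (h2.and (Ioo_mem_nhdsLT (show (0 : ℝ) < 1 by norm_num)))
  refine ⟨‖a'‖ + 1, ?_⟩
  have hconv : Convex ℝ ((fun r : ℝ => (r : ℂ) * η) '' Set.Ioo l 1) :=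
    (convex_Ioo l 1).linear_image
      ((LinearMap.mulRight ℝ η).comp Complex.ofRealCLM.toLinearMap)
  have hmv : ∀ r ∈ Set.Ioo l 1, ∀ s ∈ Set.Ioo l 1,
      ‖α ((s : ℂ) * η) - α ((r : ℂ) * η)‖ ≤ (‖a'‖ + 1) * ‖(s : ℂ) * η - (r : ℂ) * η‖ := by
    intro r hr s hs
    refine hconv.norm_image_sub_le_of_norm_deriv_le (f := α) ?_ ?_ ⟨r, hr, rfl⟩ ⟨s, hs, rfl⟩
    · rintro _ ⟨x, hx, rfl⟩
      refine hα.analytic.differentiableAt (Metric.isOpen_ball.mem_nhds ?_)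
      obtain ⟨_, hx0, hx1⟩ := hl' hx
      rw [mem_ball_zero_iff, norm_mul, hη, mul_one, Complex.norm_real, Real.norm_of_nonneg hx0.le]
      exact hx1
    · rintro _ ⟨x, hx, rfl⟩
      exact (hl' hx).1.le
  filter_upwards [Ioo_mem_nhdsLT hl] with r hr
  have hlim := ((h.tendsto_radial hη).sub_const (α ((r : ℂ) * η))).norm
  have hlim2 : Tendsto (fun s : ℝ => (‖a'‖ + 1) * ‖(s : ℂ) * η - (r : ℂ) * η‖) (𝓝[<] 1)
      (𝓝 ((‖a'‖ + 1) * ‖η - (r : ℂ) * η‖)) :=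
    ((((ModelSpaces.tendsto_radial hη).mono_right nhdsWithin_le_nhds).sub_const _).norm).const_mul _
  have hle := le_of_tendsto_of_tendsto hlim hlim2 (by
    filter_upwards [Ioo_mem_nhdsLT hl] with s hs using hmv r hr s hs)
  rw [norm_sub_rev]
  refine hle.trans_eq ?_
  rw [← one_sub_mul, norm_mul, hη, mul_one, ← Complex.ofReal_one, ← Complex.ofReal_sub,
    Complex.norm_real, Real.norm_of_nonneg (by linarith [hr.2])]

/-- Fatou's lemma along `w = rη`: the difference quotient at `w` has the norm of the kernel there,
and these norms stay bounded. -/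
theorem HasADC.memLp_diffQuot {η a : ℂ} (hα : IsInner α) (h : HasADC α η a) (hη : ‖η‖ = 1) :
    MemLp (fun t => (bdry α t - a) / (pt t - η)) 2 arc := by
  obtain ⟨M, hM⟩ := h.exists_radial_bound hα hη
  have hw : ∀ n, ‖(radius n : ℂ) * η‖ < 1 := fun n => norm_radius_mul_le hη.le
  have hmeas : ∀ n, AEStronglyMeasurable
      (fun t => (bdry α t - α ((radius n : ℂ) * η)) / (pt t - (radius n : ℂ) * η)) arc :=
    fun n => (hα.isHardy_diffQuot (hw n)).1.1
  have hlim : ∀ᵐ t ∂arc, Tendsto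
      (fun n => (bdry α t - α ((radius n : ℂ) * η)) / (pt t - (radius n : ℂ) * η)) atTop
      (𝓝 ((bdry α t - a) / (pt t - η))) := by
    filter_upwards [ae_pt_ne η] with t ht
    have h1 := (h.tendsto_radial hη).comp tendsto_radius
    have h2 := ((ModelSpaces.tendsto_radial hη).mono_right nhdsWithin_le_nhds).comp tendsto_radius
    exact (h1.const_sub _).div (h2.const_sub _) (sub_ne_zero.mpr ht)
  refine ⟨aestronglyMeasurable_of_tendsto_ae atTop hmeas hlim, ?_⟩
  -- With `r = radius n`, `(1 - r²) ‖k‖² = 1 - |α(rη)|² ≤ 2 (1 - |α(rη)|) ≤ 2 M (1 - r)`, using `|a|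
  -- = 1`; hence `‖k‖² ≤ 2 M`.
  refine (Lp.eLpNorm_le_of_ae_tendsto (C := ENNReal.ofReal √(2 * M)) ?_ hmeas hlim).trans_lt
    ENNReal.ofReal_lt_top
  filter_upwards [tendsto_radius.eventually hM] with n hn
  obtain ⟨k, hk⟩ := hα.exists_kernel (hw n).le (hα.isHardy_diffQuot (hw n))
  rw [hα.eLpNorm_diffQuot hk]
  refine ENNReal.ofReal_le_ofReal (Real.le_sqrt_of_sq_le ?_)
  have h1 := hα.norm_sq_kernel (hw n) hk
  rw [norm_mul, hη, mul_one, Complex.norm_real, Real.norm_of_nonneg (radius_nonneg n)] at h1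
  have h2 := norm_sub_norm_le a (α ((radius n : ℂ) * η))
  rw [h.unimodular, norm_sub_rev] at h2
  have hr0 := radius_nonneg n
  have hr1 := radius_lt_one n
  refine le_of_mul_le_mul_left ?_ (sub_pos.mpr hr1)
  nlinarith [sq_nonneg (1 - ‖α ((radius n : ℂ) * η)‖), mul_nonneg (mul_nonneg hr0
    (sub_pos.mpr hr1).le) (sq_nonneg ‖k‖)]

theorem HasADC.isHardy_diffQuot {η a : ℂ} (hα : IsInner α) (h : HasADC α η a) (hη : ‖η‖ = 1) :
    IsHardy fun t => (bdry α t - a) / (pt t - η) := by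
  refine IsHardy.of_pt_sub_mul_of_norm_eq_one (h.memLp_diffQuot hα hη) hη
    ((hα.isHardy_bdry.sub (isHardy_const a)).congr ?_)
  filter_upwards [ae_pt_ne η] with t ht
  rw [mul_div_cancel₀ _ (sub_ne_zero.mpr ht)]

end ModelSpaces

theorem mainTheorem4 (α β : ℂ → ℂ) (hα : IsInner α) (hβ : IsInner β)
    (hα' : NonconstantOnDisk α) (hβ' : NonconstantOnDisk β) :
    (∀ w : ℂ, ‖w‖ < 1 →
      ∃ (kα kα' : modelSpace α) (kβ kβ' : modelSpace β),
        ((kα : L2) : Circ → ℂ) =ᵐ[arc] kernel α w (α w) ∧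
        ((kα' : L2) : Circ → ℂ) =ᵐ[arc] conjKernel α w ∧
        ((kβ : L2) : Circ → ℂ) =ᵐ[arc] kernel β w (β w) ∧
        ((kβ' : L2) : Circ → ℂ) =ᵐ[arc] conjKernel β w ∧
        rankOne ℂ kβ' kα ∈ toeplitzClass α β ∧
        rankOne ℂ kβ kα' ∈ toeplitzClass α β ∧
        IsToeplitz (rankOne ℂ kβ' kα) (fun t => bdry β t / (pt t - w)) ∧
        IsToeplitz (rankOne ℂ kβ kα') (fun t => conj (bdry α t) / (conj (pt t) - conj w))) ∧
    (∀ η a b : ℂ, ‖η‖ = 1 → HasADC α η a → HasADC β η b →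
      ∃ (kα : modelSpace α) (kβ : modelSpace β),
        ((kα : L2) : Circ → ℂ) =ᵐ[arc] kernel α η a ∧
        ((kβ : L2) : Circ → ℂ) =ᵐ[arc] kernel β η b ∧
        rankOne ℂ kβ kα ∈ toeplitzClass α β ∧
        IsToeplitz (rankOne ℂ kβ kα)
          (fun t => kernel β η b t + conj (kernel α η a t) - 1)) := by
  refine ⟨fun w hw => ?_, fun η a b hη ha hb => ?_⟩
  · obtain ⟨kα, hkα⟩ := hα.exists_kernel hw.le (hα.isHardy_diffQuot hw)
    obtain ⟨kβ, hkβ⟩ := hβ.exists_kernel hw.le (hβ.isHardy_diffQuot hw)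
    obtain ⟨kα', hkα'⟩ := hα.exists_conjKernel hw
    obtain ⟨kβ', hkβ'⟩ := hβ.exists_conjKernel hw
    have h1 := isToeplitz_conjKernel_kernel hα hβ hw hkα hkβ'
    have h2 := isToeplitz_kernel_conjKernel hα hβ hw hkα' hkβ
    exact ⟨kα, kα', kβ, kβ', hkα, hkα', hkβ, hkβ', ⟨_, h1⟩, ⟨_, h2⟩, h1, h2⟩
  · have hFα := ha.isHardy_diffQuot hα hη
    have hFβ := hb.isHardy_diffQuot hβ hη
    obtain ⟨kα, hkα⟩ := hα.exists_kernel hη.le hFα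
    obtain ⟨kβ, hkβ⟩ := hβ.exists_kernel hη.le hFβ
    have h := isToeplitz_boundary_kernels hα hβ hη hFβ hkα hkβ
    exact ⟨kα, kβ, hkα, hkβ, ⟨_, h⟩, h⟩
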